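/- Let $T\in\{0,1\}^{k\times k}$, let $\Sigma^+=\{x\in\{1,\dots,k\}^{\mathbb N}: T_{x_ix_{i+1}}=1\ \forall i\ge 0\}$ be the corresponding one-sided subshift of finite type with shift $\sigma$, and assume that $\Sigma^+$ is non-empty and that $\sigma$ is topologically mixing. Let $\lambda>1$, let $d(x,y)=\lambda^{-n}$ with $n=\min\{i: x_i\ne y_i\}$ for $x\neq y$ (and $d(x,x)=0$), let $0<\alpha\le 1$, and put $\mathrm{Hold}_\alpha(f)=\sup_{0<d(x,y)\le 1}|f(x)-f(y)|/d(x,y)^\alpha$. Let $A:\Sigma^+\to\mathbb R$ be $\alpha$-Hölder, i.e. $\mathrm{Hold}_\alpha(A)<\infty$. Let $m=\sup_\nu\int A\,d\nu$ over the $\sigma$-invariant Borel probability measures $\nu$, and call an invariant probability $\mu$ maximizing if $\int A\,d\mu=m$. For $x,y\in\Sigma^+$ and $\delta>0$ define $$S_\delta(x,y)=\sup\Big\{\sum_{i=0}^{n-1}\big[A(\sigma^iz)-m\big] : n>0,\ \sigma^nz=y,\ d(z,x)<\delta\Big\},\qquad S(x,y)=\lim_{\delta\to0^+}S_\delta(x,y)\in[-\infty,\infty],$$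 and let $\mathfrak S=\{x\in\Sigma^+: S(x,x)=0\}$. Then: 1. There is $Q>0$ such that $S_\delta(x,y)<Q$ for all $x,y\in\Sigma^+$ and $\delta>0$. 2. $S(x,x)\le 0$ for all $x$. 3. $S(x,y)+S(y,z)\le S(x,z)$ for all $x,y,z$. 4. $\mathfrak S$ is closed, non-empty and forward invariant ($\sigma(\mathfrak S)\subseteq\mathfrak S$). An invariant probability measure $\mu$ is maximizing if and only if $\operatorname{supp}\mu\subseteq\mathfrak S$. 5. If $x\in\mathfrak S$, then $W(y)=S(x,y)$ is finite for every $y$ and $\alpha$-Hölder continuous, with $\mathrm{Hold}_\alpha(W)\le C\,\mathrm{Hold}_\alpha(A)$, where $C$ depends only on $\lambda$, $\alpha$ and $\Sigma^+$; and $|W(y)-W(z)|\le C_0\,\mathrm{Hold}_\alpha(A)\,d(y,z)^\alpha$ whenever $d(y,z)\le\lambda^{-1}$, where $C_0$ depends only on $\lambda$ and $\alpha$. Moreover $W(z)-W(y)\ge S(y,z)$ for all $y,z$. 6. With $x$ and $W$ as in 5, the function $B=A-m+W-W\circ\sigma$ is $\alpha$-Hölder continuous, $B\le 0$, $\int B\,d\nu=\int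 A\,d\nu-m$ for every invariant probability $\nu$, $\int B\,d\mu=0$ for every maximizing $\mu$, and $B=0$ on $\mathfrak S$; in particular $B=0$, i.e. $A=W\circ\sigma-W+m$, on $\operatorname{supp}\mu$ for every maximizing $\mu$. 7. If $\mu$ is maximizing, then every invariant probability $\nu$ with $\operatorname{supp}\nu\subseteq\operatorname{supp}\mu$ is maximizing. If $A$ has a unique maximizing measure $\mu$, then $\mathfrak S$ and $\operatorname{supp}\mu$ are uniquely ergodic, i.e. each carries exactly one invariant probability measure. -/

import Mathlib

open MeasureTheory Filter Topology
open scoped ENNReal NNReal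

noncomputable section

namespace SFTMax

/-- The one-sided subshift of finite type of a transition relation `T` (that is, of a `0`-`1`
matrix) on the finite alphabet `Fin k`. It carries the product topology and its Borel sets. -/
abbrev Subshift {k : ℕ} (T : Fin k → Fin k → Prop) : Type :=
  {x : ℕ → Fin k // ∀ i, T (x i) (x (i + 1))}

variable {k : ℕ} {T : Fin k → Fin k → Prop}

/-- The shift map `σ`. -/
def shift (x : Subshift T) : Subshift T :=
  ⟨fun i => x.1 (i + 1), fun i => x.2 (i + 1)⟩

/-- Topological mixing of the shift. -/
def IsTopMixing (T : Fin k → Fin k → Prop) : Prop :=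
  ∀ U V : Set (Subshift T), IsOpen U → IsOpen V → U.Nonempty → V.Nonempty →
    ∃ N : ℕ, ∀ n ≥ N, (U ∩ shift^[n] ⁻¹' V).Nonempty

/-- The metric `d(x, y) = lam ^ (-n)`, `n = min {i | x i ≠ y i}`, with expansion rate `lam > 1`. -/
def symDist (lam : ℝ) (x y : Subshift T) : ℝ :=
  open Classical in if x = y then 0 else (lam ^ PiNat.firstDiff x.1 y.1)⁻¹

/-- `sup |f x - f y| / d(x, y) ^ α` over the pairs with `0 < d(x, y) ≤ r`, in `[0, ∞]`. -/
def holdUpTo (lam α r : ℝ) (f : Subshift T → ℝ) : ℝ≥0∞ :=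
  ⨆ (x : Subshift T) (y : Subshift T) (_ : 0 < symDist lam x y ∧ symDist lam x y ≤ r),
    ENNReal.ofReal (|f x - f y| / symDist lam x y ^ α)

/-- The Hölder constant of exponent `α`: the supremum over `0 < d(x, y) ≤ 1`. -/
def hold (lam α : ℝ) (f : Subshift T → ℝ) : ℝ≥0∞ := holdUpTo lam α 1 f

/-- `f` is `α`-Hölder continuous. -/
def IsHolder (lam α : ℝ) (f : Subshift T → ℝ) : Prop := hold lam α f < ∞

/-- `ν` is a shift-invariant Borel probability measure. -/
def IsInvProb (ν : Measure (Subshift T)) : Prop :=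
  IsProbabilityMeasure ν ∧ MeasurePreserving shift ν ν

/-- `m(A)`: the supremum of `∫ A dν` over the invariant Borel probabilities `ν`. -/
def maxMean (A : Subshift T → ℝ) : ℝ :=
  sSup {r : ℝ | ∃ ν : Measure (Subshift T), IsInvProb ν ∧ ∫ x, A x ∂ν = r}

/-- `μ` is a maximizing measure for `A`. -/
def IsMaximizing (A : Subshift T → ℝ) (μ : Measure (Subshift T)) : Prop :=
  IsInvProb μ ∧ ∫ x, A x ∂μ = maxMean A

/-- `S_δ(x, y)`: the supremum of `∑_{i < n} (A (σ^i z) - m(A))` over `n > 0` and over `z` with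
`σ^n z = y` and `d(z, x) < δ`. -/
def actionAt (lam : ℝ) (A : Subshift T → ℝ) (δ : ℝ) (x y : Subshift T) : EReal :=
  ⨆ (n : ℕ) (z : Subshift T) (_ : 0 < n ∧ shift^[n] z = y ∧ symDist lam z x < δ),
    ((∑ i ∈ Finset.range n, (A (shift^[i] z) - maxMean A) : ℝ) : EReal)

/-- The action potential `S(x, y)`, the limit of `S_δ(x, y)` as `δ → 0+`, written as the infimum
over `δ > 0` (see `tendsto_actionAt`). -/
def action (lam : ℝ) (A : Subshift T → ℝ) (x y : Subshift T) : EReal :=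
  ⨅ (δ : ℝ) (_ : 0 < δ), actionAt lam A δ x y

/-- The set `𝔖` of the points `x` with `S(x, x) = 0`. -/
def zeroSet (lam : ℝ) (A : Subshift T → ℝ) : Set (Subshift T) :=
  {x | action lam A x x = 0}

/-- Exactly one shift-invariant Borel probability is carried by `K`. -/
def UniquelyErgodicOn (K : Set (Subshift T)) : Prop :=
  ∃! ν : Measure (Subshift T), IsInvProb ν ∧ ν Kᶜ = 0

theorem actionAt_mono (lam : ℝ) (A : Subshift T → ℝ) (x y : Subshift T) :
    Monotone fun δ => actionAt lam A δ x y := by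
  intro δ δ' h
  refine iSup_mono fun n => iSup_mono fun z => ?_
  exact iSup_mono' fun hz => ⟨⟨hz.1, hz.2.1, hz.2.2.trans_le h⟩, le_rfl⟩

theorem tendsto_actionAt (lam : ℝ) (A : Subshift T → ℝ) (x y : Subshift T) :
    Tendsto (fun δ => actionAt lam A δ x y) (𝓝[>] 0) (𝓝 (action lam A x y)) := by
  have h := (actionAt_mono lam A x y).tendsto_nhdsGT 0
  rwa [sInf_image] at h

/-- The metric induces the topology of the subshift. -/
theorem nhds_basis_symDist {lam : ℝ} (hlam : 1 < lam) (x : Subshift T) :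
    (𝓝 x).HasBasis (fun r : ℝ => 0 < r) (fun r => {y | symDist lam y x < r}) := by
  have hpos : ∀ n : ℕ, 0 < (lam ^ n)⁻¹ := fun n => inv_pos.2 (pow_pos (by linarith) n)
  have hcyl : ∀ (n : ℕ) (y : Subshift T), symDist lam y x < (lam ^ n)⁻¹ →
      y.1 ∈ PiNat.cylinder x.1 n := by
    intro n y hy
    by_cases h : y = x
    · exact h ▸ PiNat.self_mem_cylinder _ _
    · rw [symDist, if_neg h, inv_lt_inv₀ (pow_pos (by linarith) _) (pow_pos (by linarith) _),
        pow_lt_pow_iff_right₀ hlam] at hy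
      exact (PiNat.mem_cylinder_iff_le_firstDiff (fun e => h (Subtype.ext e)) n).2 hy.le
  refine ⟨fun s => ⟨fun hs => ?_, ?_⟩⟩
  · obtain ⟨u, hu, hus⟩ := mem_nhds_subtype _ x s |>.1 hs
    obtain ⟨v, hv, hxv, hvu⟩ :=
      (PiNat.isTopologicalBasis_cylinders fun _ : ℕ => Fin k).mem_nhds_iff.1 hu
    obtain ⟨w, n, rfl⟩ := hv
    refine ⟨(lam ^ n)⁻¹, hpos n, fun y hy => hus (hvu ?_)⟩
    rw [← PiNat.mem_cylinder_iff_eq.1 hxv]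
    exact hcyl n y hy
  · rintro ⟨r, hr, hs⟩
    obtain ⟨n, hn⟩ := exists_pow_lt_of_lt_one hr (inv_lt_one_of_one_lt₀ hlam)
    have ho : IsOpen {y : Subshift T | y.1 ∈ PiNat.cylinder x.1 n} :=
      (PiNat.isOpen_cylinder _ x.1 n).preimage continuous_subtype_val
    refine mem_of_superset (ho.mem_nhds (PiNat.self_mem_cylinder _ _)) fun y hy => hs ?_
    by_cases h : y = x
    · simpa [symDist, h] using hr
    · have := (PiNat.mem_cylinder_iff_le_firstDiff (fun e => h (Subtype.ext e)) n).1 hy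
      simp only [Set.mem_ofPred_eq, symDist, if_neg h]
      refine lt_of_le_of_lt ?_ (inv_pow lam n ▸ hn)
      exact inv_anti₀ (pow_pos (by linarith) _) (pow_le_pow_right₀ hlam.le this)

end SFTMax

end

open SFTMax

/-! ### Symbolic dynamics: gluing, closing and uniform gaps. -/

namespace SFTMax

variable {k : ℕ} {T : Fin k → Fin k → Prop}

/-! Put φ = A - m. On a Markov shift a prefix can be followed by any point that starts with the
right symbol, and a near-return can be closed to a periodic orbit. Since φ is Hölder, either surgery
changes a Birkhoff sum by at most a constant times r^N, with r = λ^(-α) and N the length of the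
overlap (`IsExpHolder.birkhoffSum_sub_le`). Periodic orbits carry invariant measures, so their sums
of φ are nonpositive; closing an arbitrary segment through a gap of fixed length g bounds all sums
by Q = H(1/(1-r) + g), where H is the Hölder constant of A. Closing also gives S(x,x) ≤ 0, and
concatenation gives the triangle inequality.

The bound Q yields a Hölder sub-action u, the supremum of the sums along all orbits ending at a
point. Then φ + u - u∘σ ≤ 0 has the same integrals as φ. By compactness it vanishes along some
orbit, whose cluster points lie in 𝔖; this proves 𝔖 non-empty without the existence of a maximizing
measure. For maximizing μ the function vanishes on supp μ, and Poincaré recurrence puts supp μ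
inside 𝔖.

For x in 𝔖, cheap loops at x can be made as long as desired. Put before any orbit, they make S(x,·)
finite and Hölder. The triangle inequality makes W = S(x,·) a sub-action, and for y in 𝔖 the return
from σy to y costs exactly -φ(y), so B = 0 on 𝔖. Hence measures supported in 𝔖 are maximizing, and
unique ergodicity follows. -/

/-- The points `x` and `y` have the same first `N` symbols. -/
def Agree (N : ℕ) (x y : Subshift T) : Prop := ∀ i < N, x.1 i = y.1 i

theorem Agree.refl (N : ℕ) (x : Subshift T) : Agree N x x := fun _ _ => rfl

theorem Agree.symm {N : ℕ} {x y : Subshift T} (h : Agree N x y) : Agree N y x :=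
  fun i hi => (h i hi).symm

theorem Agree.trans {N : ℕ} {x y z : Subshift T} (h : Agree N x y) (h' : Agree N y z) :
    Agree N x z := fun i hi => (h i hi).trans (h' i hi)

theorem Agree.mono {M N : ℕ} {x y : Subshift T} (h : Agree N x y) (hMN : M ≤ N) : Agree M x y :=
  fun i hi => h i (hi.trans_le hMN)

theorem iterate_shift_apply (n i : ℕ) (x : Subshift T) : (shift^[n] x).1 i = x.1 (i + n) := by
  induction n generalizing x with
  | zero => rfl
  | succ n ih =>
    rw [Function.iterate_succ_apply, ih, shift]
    simp only [add_assoc]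

theorem Agree.shift {N : ℕ} {x y : Subshift T} (h : Agree (N + 1) x y) :
    Agree N (shift x) (shift y) := fun i hi => h (i + 1) (by omega)

/-- A prefix of `z` of length `n` may be followed by any point starting like `σ^n z`. -/
theorem exists_glue {n N : ℕ} {z y : Subshift T} (hN : 0 < N) (h : Agree N (shift^[n] z) y) :
    ∃ w : Subshift T, shift^[n] w = y ∧ Agree (n + N) w z := by
  have h' : ∀ i < N, z.1 (i + n) = y.1 i := fun i hi => by
    rw [← h i hi, iterate_shift_apply]
  refine ⟨⟨fun i => if i < n then z.1 i else y.1 (i - n), fun i => ?_⟩, ?_, fun i hi => ?_⟩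
  · by_cases h1 : i + 1 < n
    · simpa [h1, (by omega : i < n)] using z.2 i
    · by_cases h2 : i < n
      · have h3 : i + 1 = n := by omega
        have := h' 0 hN
        simp only [h2, if_true, h3, lt_irrefl, if_false, Nat.sub_self, ← this, zero_add]
        simpa [h3] using z.2 i
      · simpa only [h1, h2, if_false, (by omega : i + 1 - n = i - n + 1)] using y.2 (i - n)
  · refine Subtype.ext (funext fun i => ?_)
    rw [iterate_shift_apply]
    simp
  · by_cases h1 : i < n
    · simp [h1]
    · simp only [h1, if_false]
      rw [← h' (i - n) (by omega), Nat.sub_add_cancel (not_lt.1 h1)]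

/-- Closing lemma: a point that returns near itself is shadowed by a periodic point. -/
theorem exists_periodic {n N : ℕ} {z : Subshift T} (hn : 0 < n) (hN : 0 < N)
    (h : Agree N (shift^[n] z) z) :
    ∃ p : Subshift T, shift^[n] p = p ∧ Agree (n + N) p z := by
  have h' : ∀ i < N, z.1 (i + n) = z.1 i := fun i hi => by
    rw [← h i hi, iterate_shift_apply]
  refine ⟨⟨fun i => z.1 (i % n), fun i => ?_⟩, ?_, fun i => ?_⟩
  · have hlt := Nat.mod_lt i hn
    by_cases h1 : i % n + 1 < n
    · have : (i + 1) % n = i % n + 1 := by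
        rw [Nat.add_mod, Nat.mod_eq_of_lt (a := 1) (by omega), Nat.mod_eq_of_lt h1]
      simpa only [this] using z.2 (i % n)
    · have h2 : i % n + 1 = n := by omega
      have : (i + 1) % n = 0 := by
        rw [← Nat.mod_add_mod, h2, Nat.mod_self]
      have h3 := z.2 (i % n)
      rw [h2] at h3
      have h4 := h' 0 hN
      rw [zero_add] at h4
      rwa [h4, ← this] at h3
  · refine Subtype.ext (funext fun i => ?_)
    rw [iterate_shift_apply]
    simp
  · induction i using Nat.strong_induction_on with
    | _ i ih =>
      intro hi
      by_cases h1 : i < n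
      · simp [Nat.mod_eq_of_lt h1]
      · have h2 := ih (i - n) (by omega) (by omega)
        have h3 := h' (i - n) (by omega)
        rw [Nat.sub_add_cancel (by omega)] at h3
        rw [h3, ← h2]
        exact congrArg z.1 (Nat.mod_eq_sub_mod (by omega))

theorem isOpen_setOf_agree (N : ℕ) (x : Subshift T) : IsOpen {y | Agree N y x} := by
  have : {y : Subshift T | Agree N y x} = ⋂ i ∈ Set.Iio N, {y | y.1 i = x.1 i} := by
    ext; simp [Agree]
  rw [this]
  refine (Set.finite_Iio N).isOpen_biInter fun i _ => ?_
  have hc : Continuous fun y : Subshift T => y.1 i :=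
    (continuous_apply i).comp continuous_subtype_val
  exact (isOpen_discrete {x.1 i}).preimage hc

theorem continuous_shift : Continuous (shift : Subshift T → Subshift T) :=
  continuous_induced_rng.2 <| continuous_pi fun i =>
    (continuous_apply (A := fun _ : ℕ => Fin k) (i + 1)).comp continuous_subtype_val

instance : CompactSpace (Subshift T) := by
  suffices h : IsClosed {x : ℕ → Fin k | ∀ i, T (x i) (x (i + 1))} from
    h.isClosedEmbedding_subtypeVal.compactSpace
  have : {x : ℕ → Fin k | ∀ i, T (x i) (x (i + 1))} =
      ⋂ i, (fun x : ℕ → Fin k => (x i, x (i + 1))) ⁻¹' {p | T p.1 p.2} := by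
    ext; simp
  rw [this]
  exact isClosed_iInter fun i => (isClosed_discrete _).preimage
    ((continuous_apply i).prodMk (continuous_apply (i + 1)))

instance : SecondCountableTopology (Subshift T) :=
  TopologicalSpace.Subtype.secondCountableTopology {x : ℕ → Fin k | ∀ i, T (x i) (x (i + 1))}

/-- Under mixing, any two points are joined by words of one fixed length. -/
theorem IsTopMixing.exists_gap (hT : IsTopMixing T) :
    ∃ g : ℕ, 0 < g ∧ ∀ x y : Subshift T, ∃ z : Subshift T, Agree 1 z x ∧ shift^[g] z = y := by
  classical
  -- Whether a gap length works depends only on the two first symbols, so finitely many pairs have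
  -- to be considered. Pairs with a symbol that starts no point get the harmless value 0.
  have key : ∀ p : Fin k × Fin k, ∃ N : ℕ, ∀ x y : Subshift T, x.1 0 = p.1 → y.1 0 = p.2 →
      ∀ n ≥ N, ∃ z : Subshift T, Agree 1 z x ∧ Agree 1 (shift^[n] z) y := by
    intro p
    by_cases h : ∃ x y : Subshift T, x.1 0 = p.1 ∧ y.1 0 = p.2
    · obtain ⟨x, y, hx, hy⟩ := h
      obtain ⟨N, hN⟩ := hT _ _ (isOpen_setOf_agree 1 x) (isOpen_setOf_agree 1 y)
        ⟨x, Agree.refl _ _⟩ ⟨y, Agree.refl _ _⟩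
      refine ⟨N, fun x' y' hx' hy' n hn => ?_⟩
      obtain ⟨z, hz, hz'⟩ := hN n hn
      refine ⟨z, hz.trans fun i hi => ?_, Agree.trans hz' fun i hi => ?_⟩
      · obtain rfl : i = 0 := by omega
        rw [hx, hx']
      · obtain rfl : i = 0 := by omega
        rw [hy, hy']
    · exact ⟨0, fun x y hx hy => (h ⟨x, y, hx, hy⟩).elim⟩
  choose N hN using key
  refine ⟨Finset.univ.sup N + 1, by omega, fun x y => ?_⟩
  obtain ⟨z, hz, hz'⟩ := hN (x.1 0, y.1 0) x y rfl rfl (Finset.univ.sup N + 1)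
    ((Finset.le_sup (Finset.mem_univ _)).trans (Nat.le_succ _))
  obtain ⟨w, hw, hw'⟩ := exists_glue Nat.one_pos hz'
  exact ⟨w, (hw'.mono (by omega)).trans hz, hw⟩

/-- `φ` varies by at most `H * r ^ N` on the cylinders of length `N`. -/
structure IsExpHolder (φ : Subshift T → ℝ) (H r : ℝ) : Prop where
  pos : 0 < r
  lt_one : r < 1
  nonneg : 0 ≤ H
  bound : ∀ (N : ℕ) (x y : Subshift T), Agree N x y → |φ x - φ y| ≤ H * r ^ N

/-! ### Bounded distortion of Birkhoff sums. -/

section Holder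

variable {φ : Subshift T → ℝ} {H r : ℝ}

theorem IsExpHolder.tendsto (h : IsExpHolder φ H r) (c : ℝ) :
    Tendsto (fun N => c * r ^ N) atTop (𝓝 0) := by
  simpa using (tendsto_pow_atTop_nhds_zero_of_lt_one h.pos.le h.lt_one).const_mul c

theorem continuous_of_agree {f : Subshift T → ℝ} {c : ℝ} (hr0 : 0 ≤ r) (hr1 : r < 1)
    (hf : ∀ (N : ℕ) (x y : Subshift T), 0 < N → Agree N x y → |f x - f y| ≤ c * r ^ N) :
    Continuous f := by
  refine continuous_iff_continuousAt.2 fun x => Metric.tendsto_nhds.2 fun ε hε => ?_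
  have : Tendsto (fun N => c * r ^ N) atTop (𝓝 0) := by
    simpa using (tendsto_pow_atTop_nhds_zero_of_lt_one hr0 hr1).const_mul c
  obtain ⟨N, hN, hN0⟩ := ((this.eventually_lt_const hε).and (eventually_gt_atTop 0)).exists
  filter_upwards [(isOpen_setOf_agree N x).mem_nhds (Agree.refl N x)] with y hy
  exact (hf N y x hN0 hy).trans_lt hN

theorem IsExpHolder.continuous (h : IsExpHolder φ H r) : Continuous φ :=
  continuous_of_agree h.pos.le h.lt_one fun N x y _ => h.bound N x y

/-- Bounded distortion. -/
theorem IsExpHolder.birkhoffSum_sub_le (h : IsExpHolder φ H r) {n N : ℕ} {x y : Subshift T}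
    (hxy : Agree (n + N) x y) :
    |birkhoffSum shift φ n x - birkhoffSum shift φ n y| ≤ H * (1 - r)⁻¹ * r ^ N := by
  have h1 : 0 < 1 - r := sub_pos.2 h.lt_one
  have h0 := h.pos
  have hH := h.nonneg
  -- The factor 1 - r^n of the partial geometric sum is what lets the induction close.
  suffices |birkhoffSum shift φ n x - birkhoffSum shift φ n y| ≤
      H * (1 - r)⁻¹ * r ^ N * (1 - r ^ n) by
    refine this.trans (mul_le_of_le_one_right (by positivity) ?_)
    have : 0 < r ^ n := by positivity
    linarith
  induction n generalizing x y with
  | zero => simp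
  | succ n ih =>
    have h2 := ih (x := shift x) (y := shift y) (Agree.shift (hxy.mono (by omega)))
    have h3 := h.bound _ _ _ hxy
    rw [birkhoffSum_succ', birkhoffSum_succ', add_sub_add_comm]
    refine (abs_add_le _ _).trans ((add_le_add h3 h2).trans ?_)
    have h4 : H * (1 - r)⁻¹ * r ^ N * (1 - r ^ (n + 1)) =
        H * (1 - r)⁻¹ * r ^ N * (1 - r ^ n) + H * r ^ (n + N) := by
      field_simp
      ring
    have h5 : H * r ^ (n + 1 + N) ≤ H * r ^ (n + N) :=
      mul_le_mul_of_nonneg_left (pow_le_pow_of_le_one h0.le h.lt_one.le (by omega)) hH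
    linarith

theorem birkhoffSum_abs_le (hφ : ∀ x, |φ x| ≤ H) (n : ℕ) (x : Subshift T) :
    |birkhoffSum shift φ n x| ≤ n * H := by
  refine (Finset.abs_sum_le_sum_abs _ _).trans ((Finset.sum_le_sum fun i _ => hφ _).trans ?_)
  simp

/-- If the Birkhoff sums over periodic orbits are nonpositive, all Birkhoff sums are bounded above. -/
theorem IsExpHolder.birkhoffSum_le (h : IsExpHolder φ H r) (hb : ∀ x, |φ x| ≤ H)
    (hper : ∀ (n : ℕ) (p : Subshift T), 0 < n → shift^[n] p = p → birkhoffSum shift φ n p ≤ 0)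
    {g : ℕ} (hg : 0 < g)
    (hgap : ∀ x y : Subshift T, ∃ z : Subshift T, Agree 1 z x ∧ shift^[g] z = y)
    (n : ℕ) (z : Subshift T) : birkhoffSum shift φ n z ≤ H * ((1 - r)⁻¹ + g) := by
  -- The segment of z is led back to z in g steps and closed up. The periodic sum is nonpositive,
  -- the g extra terms cost at most gH, and the distortion at most H/(1-r).
  obtain ⟨w, hw, hwz⟩ := hgap (shift^[n] z) z
  obtain ⟨v, hv, hvz⟩ := exists_glue Nat.one_pos hw.symm
  have hv' : shift^[n + g] v = z := by
    rw [add_comm, Function.iterate_add_apply, hv, hwz]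
  obtain ⟨p, hp, hpv⟩ := exists_periodic (n := n + g) (N := 1) (z := v) (by omega) Nat.one_pos
    (by rw [hv']; exact (hvz.mono (by omega)).symm)
  have h1 := hper _ _ (by omega) hp
  rw [birkhoffSum_add] at h1
  have h2 := (abs_le.1 (birkhoffSum_abs_le hb g (shift^[n] p))).1
  have h3 := (abs_le.1 (h.birkhoffSum_sub_le (n := n) (N := 0) (x := z) (y := p)
    ((hvz.symm.mono (by omega)).trans (hpv.symm.mono (by omega))))).2
  rw [pow_zero] at h3
  linarith

end Holder

end SFTMax

/-! ### The action potential on cylinders, with real lower bounds. -/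

namespace SFTMax

variable {k : ℕ} {T : Fin k → Fin k → Prop} {φ : Subshift T → ℝ} {H r : ℝ}

/-- The action potential of `φ` from `x` to `y` is at least `c`. -/
def ActionGE (φ : Subshift T → ℝ) (x y : Subshift T) (c : ℝ) : Prop :=
  ∀ c' < c, ∀ M : ℕ, ∃ (n : ℕ) (z : Subshift T),
    0 < n ∧ shift^[n] z = y ∧ Agree M z x ∧ c' < birkhoffSum shift φ n z

namespace IsExpHolder

theorem distortion_nonneg (h : IsExpHolder φ H r) : 0 ≤ H * (1 - r)⁻¹ :=
  mul_nonneg h.nonneg (inv_nonneg.2 (sub_nonneg.2 h.lt_one.le))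

theorem exists_distortion_lt (h : IsExpHolder φ H r) {ε : ℝ} (hε : 0 < ε) (M : ℕ) :
    ∃ N, M ≤ N ∧ 0 < N ∧ H * (1 - r)⁻¹ * r ^ N < ε := by
  obtain ⟨N, h1, h2⟩ := (((h.tendsto (H * (1 - r)⁻¹)).eventually_lt_const hε).and
    (eventually_ge_atTop (M + 1))).exists
  exact ⟨N, by omega, by omega, h1⟩

/-- Orbit segments compose when the second begins near the end of the first; only the first is
perturbed, since the glued point follows the second exactly. -/
theorem exists_concat (h : IsExpHolder φ H r) {n m N : ℕ} {w u y z : Subshift T} (hN : 0 < N)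
    (hw : shift^[n] w = y) (hu : shift^[m] u = z) (huy : Agree N u y) :
    ∃ v : Subshift T, shift^[n + m] v = z ∧ Agree (n + N) v w ∧
      birkhoffSum shift φ n w + birkhoffSum shift φ m u - H * (1 - r)⁻¹ * r ^ N ≤
        birkhoffSum shift φ (n + m) v := by
  obtain ⟨v, hv, hvw⟩ := exists_glue (n := n) (z := w) hN (hw ▸ huy.symm)
  refine ⟨v, by rw [add_comm, Function.iterate_add_apply, hv, hu], hvw, ?_⟩
  rw [birkhoffSum_add, hv]
  linarith [(abs_le.1 (h.birkhoffSum_sub_le hvw)).1]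

theorem exists_transfer (h : IsExpHolder φ H r) {n N : ℕ} {z y y' : Subshift T} (hN : 0 < N)
    (hz : shift^[n] z = y) (hy : Agree N y y') :
    ∃ z' : Subshift T, shift^[n] z' = y' ∧ Agree (n + N) z' z ∧
      birkhoffSum shift φ n z - H * (1 - r)⁻¹ * r ^ N ≤ birkhoffSum shift φ n z' := by
  obtain ⟨v, hv, hvw⟩ := exists_glue (n := n) (z := z) hN (hz ▸ hy)
  exact ⟨v, hv, hvw, by linarith [(abs_le.1 (h.birkhoffSum_sub_le hvw)).1]⟩

/-- A near-return of positive sum, closed with distortion smaller than that sum, would be a periodic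
orbit of positive sum. -/
theorem action_self_le (h : IsExpHolder φ H r)
    (hper : ∀ (n : ℕ) (p : Subshift T), 0 < n → shift^[n] p = p → birkhoffSum shift φ n p ≤ 0)
    {x : Subshift T} {c : ℝ} (hc : ActionGE φ x x c) : c ≤ 0 := by
  refine le_of_forall_lt fun c' hc' => ?_
  by_contra! h0
  obtain ⟨c'', h1, h2⟩ := exists_between hc'
  obtain ⟨N, -, hN, hN'⟩ := h.exists_distortion_lt (h0.trans_lt h1) 0
  obtain ⟨n, z, hn, hz, hzx, hlt⟩ := hc c'' h2 N
  obtain ⟨p, hp, hpz⟩ := exists_periodic (z := z) hn hN (hz ▸ hzx.symm)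
  linarith [hper n p hn hp, (abs_le.1 (h.birkhoffSum_sub_le hpz)).1]

theorem action_triangle (h : IsExpHolder φ H r) {x y z : Subshift T} {a b : ℝ}
    (ha : ActionGE φ x y a) (hb : ActionGE φ y z b) : ActionGE φ x z (a + b) := by
  intro c hc M
  obtain ⟨N, hMN, hN, hN'⟩ := h.exists_distortion_lt (ε := (a + b - c) / 3) (by linarith) M
  obtain ⟨n, w, hn, hw, hwx, hw'⟩ := ha (a - (a + b - c) / 3) (by linarith) M
  obtain ⟨m, u, hm, hu, huy, hu'⟩ := hb (b - (a + b - c) / 3) (by linarith) N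
  obtain ⟨v, hv, hvw, hle⟩ := h.exists_concat hN hw hu huy
  exact ⟨n + m, v, by omega, hv, (hvw.mono (by omega)).trans hwx, by linarith⟩

/-- The points of zero self-action return with almost zero cost after arbitrarily long times. -/
theorem exists_long_return (h : IsExpHolder φ H r) {x : Subshift T} (hx : ActionGE φ x x 0)
    (L M : ℕ) {ε : ℝ} (hε : 0 < ε) : ∃ (n : ℕ) (z : Subshift T),
      L < n ∧ shift^[n] z = x ∧ Agree M z x ∧ -ε < birkhoffSum shift φ n z := by
  induction L generalizing ε with
  | zero => exact hx (-ε) (by linarith) M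
  | succ L ih =>
    obtain ⟨N, hMN, hN, hN'⟩ := h.exists_distortion_lt (ε := ε / 3) (by linarith) M
    obtain ⟨n, w, hn, hw, hwx, hw'⟩ := ih (ε := ε / 3) (by linarith)
    obtain ⟨m, u, hm, hu, huy, hu'⟩ := hx (-(ε / 3)) (by linarith) N
    obtain ⟨v, hv, hvw, hle⟩ := h.exists_concat hN hw hu huy
    exact ⟨n + m, v, by omega, hv, (hvw.mono (by omega)).trans hwx, by linarith⟩

/-- The segments need not end at x: an end near x can be moved to x at the price of the distortion.
This is the test by which membership in 𝔖 is verified. -/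
theorem action_self_of_frequently (h : IsExpHolder φ H r) {x : Subshift T}
    (hx : ∀ (N : ℕ) (ε : ℝ), 0 < N → 0 < ε → ∃ (n : ℕ) (p : Subshift T),
      0 < n ∧ Agree N p x ∧ Agree N (shift^[n] p) x ∧ -ε < birkhoffSum shift φ n p) :
    ActionGE φ x x 0 := by
  intro c hc M
  obtain ⟨N, hMN, hN, hN'⟩ := h.exists_distortion_lt (ε := -c / 2) (by linarith) M
  obtain ⟨n, p, hn, hpx, hpx', hlt⟩ := hx N (-c / 2) hN (by linarith)
  obtain ⟨z, hz, hzp, hle⟩ := h.exists_transfer hN rfl hpx'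
  exact ⟨n, z, hn, hz, (hzp.mono (by omega)).trans (hpx.mono hMN), by linarith⟩

theorem isClosed_action_self (h : IsExpHolder φ H r) : IsClosed {x | ActionGE φ x x 0} := by
  refine isClosed_of_closure_subset fun x hx => h.action_self_of_frequently fun N ε hN hε => ?_
  obtain ⟨y, hyx, hy⟩ := mem_closure_iff.1 hx _ (isOpen_setOf_agree N x) (Agree.refl N x)
  obtain ⟨n, z, hn, hz, hzy, hlt⟩ := hy (-ε) (by linarith) N
  exact ⟨n, z, hn, hzy.trans hyx, hz ▸ hyx, hlt⟩

/-- Shifting a loop at x drops the term φ(z) and gains φ(x), which are close because z is near x. -/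
theorem action_self_shift (h : IsExpHolder φ H r) {x : Subshift T} (hx : ActionGE φ x x 0) :
    ActionGE φ (shift x) (shift x) 0 := by
  intro c hc M
  obtain ⟨N, hN, hN0⟩ := (((h.tendsto H).eventually_lt_const (u := -c / 2) (by linarith)).and
    (eventually_ge_atTop (M + 1))).exists
  obtain ⟨n, z, hn, hz, hzx, hlt⟩ := hx (c / 2) (by linarith) N
  refine ⟨n, shift z, hn, ?_, Agree.shift (hzx.mono hN0), ?_⟩
  · rw [← Function.iterate_succ_apply, Function.iterate_succ_apply', hz]
  · have h1 := birkhoffSum_apply_sub_birkhoffSum shift φ n z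
    rw [hz] at h1
    linarith [(abs_le.1 (h.bound N z x hzx)).2]

theorem action_shift (φ : Subshift T → ℝ) (y : Subshift T) : ActionGE φ y (shift y) (φ y) :=
  fun _ hc _ => ⟨1, y, Nat.one_pos, rfl, Agree.refl _ _, by rwa [birkhoffSum_one]⟩

theorem action_shift_self (h : IsExpHolder φ H r) {y : Subshift T} (hy : ActionGE φ y y 0) :
    ActionGE φ (shift y) y (-φ y) := by
  intro c hc M
  obtain ⟨N, hN, hN0⟩ := (((h.tendsto H).eventually_lt_const (u := (-φ y - c) / 2)
    (by linarith)).and (eventually_ge_atTop (M + 1))).exists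
  -- Return time above 1, so that the loop without its first step still has positive length.
  obtain ⟨n, z, hn, hz, hzy, hlt⟩ := h.exists_long_return hy 1 N (ε := (-φ y - c) / 2)
    (by linarith)
  obtain ⟨n, rfl⟩ : ∃ m, n = m + 1 := ⟨n - 1, by omega⟩
  refine ⟨n, shift z, by omega, hz, Agree.shift (hzy.mono hN0), ?_⟩
  rw [birkhoffSum_succ'] at hlt
  linarith [(abs_le.1 (h.bound N z y hzy)).2]

/-- The action potential from a point of zero self-action varies little on cylinders. -/
theorem action_transfer (h : IsExpHolder φ H r) {x y y' : Subshift T} {c : ℝ} {N : ℕ}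
    (hx : ActionGE φ x x 0) (hc : ActionGE φ x y c) (hN : 0 < N) (hy : Agree N y y') :
    ActionGE φ x y' (c - H * (1 - r)⁻¹ * r ^ N) := by
  intro c' hc' M
  set ε := (c - H * (1 - r)⁻¹ * r ^ N - c') / 3 with hε
  obtain ⟨N', hMN, hN0, hN'⟩ := h.exists_distortion_lt (ε := ε) (by linarith) M
  -- Moving the endpoint preserves only the first n + N symbols of a segment of length n. A loop at
  -- x longer than M placed in front keeps the start within the M-cylinder of x.
  obtain ⟨n, w, hn, hw, hwx, hw'⟩ := h.exists_long_return hx M M (ε := ε) (by linarith)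
  obtain ⟨m, u, hm, hu, huy, hu'⟩ := hc (c - ε) (by linarith) N'
  obtain ⟨u', hu1, hu2, hle⟩ := h.exists_transfer hN hu hy
  obtain ⟨v, hv, hvw, hle'⟩ := h.exists_concat hN0 hw hu huy
  obtain ⟨v', hv1, hv2, hle''⟩ := h.exists_transfer hN hv hy
  exact ⟨n + m, v', by omega, hv1,
    ((hv2.mono (by omega)).trans (hvw.mono (by omega))).trans hwx, by linarith⟩

/-- The action potential from a point of zero self-action is bounded below. -/
theorem action_lower_bound (h : IsExpHolder φ H r) (hb : ∀ x, |φ x| ≤ H) {g : ℕ} (hg : 0 < g)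
    (hgap : ∀ x y : Subshift T, ∃ z : Subshift T, Agree 1 z x ∧ shift^[g] z = y)
    {x : Subshift T} (hx : ActionGE φ x x 0) (y : Subshift T) :
    ActionGE φ x y (-(H * ((1 - r)⁻¹ + g))) := by
  intro c hc M
  have h0 := h.pos
  obtain ⟨n, w, hn, hw, hwx, hw'⟩ := h.exists_long_return hx M M
    (ε := -(H * ((1 - r)⁻¹ + g)) - c) (by linarith)
  obtain ⟨u, hux, hu⟩ := hgap x y
  obtain ⟨v, hv, hvw, hle⟩ := h.exists_concat Nat.one_pos hw hu hux
  have h1 := (abs_le.1 (birkhoffSum_abs_le hb g u)).1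
  have h2 := mul_le_of_le_one_right h.distortion_nonneg (pow_le_one₀ h0.le h.lt_one.le (n := 1))
  exact ⟨n + g, v, by omega, hv, (hvw.mono (by omega)).trans hwx, by linarith⟩

end IsExpHolder

theorem ActionGE.le_of_birkhoffSum_le {Q c : ℝ} {x y : Subshift T}
    (hQ : ∀ (n : ℕ) (z : Subshift T), birkhoffSum shift φ n z ≤ Q) (hc : ActionGE φ x y c) :
    c ≤ Q := by
  refine le_of_forall_lt fun c' hc' => ?_
  obtain ⟨n, z, -, -, -, hz⟩ := hc c' hc' 0
  exact hz.trans_le (hQ n z)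

/-! ### Sub-actions and their zero orbits. -/

/-- Upper bounded Birkhoff sums admit a Hölder sub-action. -/
theorem IsExpHolder.exists_subaction (h : IsExpHolder φ H r) {Q : ℝ}
    (hQ : ∀ (n : ℕ) (z : Subshift T), birkhoffSum shift φ n z ≤ Q)
    (hsurj : ∀ y : Subshift T, ∃ (n : ℕ) (z : Subshift T), 0 < n ∧ shift^[n] z = y) :
    ∃ u : Subshift T → ℝ, (∀ y, φ y + u y - u (shift y) ≤ 0) ∧
      ∀ (N : ℕ) (x y : Subshift T), 0 < N → Agree N x y →
        |u x - u y| ≤ H * (1 - r)⁻¹ * r ^ N := by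
  set s : Subshift T → Set ℝ := fun y =>
    {t | ∃ (n : ℕ) (z : Subshift T), 0 < n ∧ shift^[n] z = y ∧ birkhoffSum shift φ n z = t}
    with hs
  have hne : ∀ y, (s y).Nonempty := fun y => by
    obtain ⟨n, z, hn, hz⟩ := hsurj y
    exact ⟨_, n, z, hn, hz, rfl⟩
  have hbdd : ∀ y, BddAbove (s y) := fun y => ⟨Q, by
    rintro _ ⟨n, z, -, -, rfl⟩
    exact hQ n z⟩
  have hle : ∀ (N : ℕ) (x y : Subshift T), 0 < N → Agree N x y →
      sSup (s x) - sSup (s y) ≤ H * (1 - r)⁻¹ * r ^ N := by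
    intro N x y hN hxy
    rw [sub_le_iff_le_add]
    refine csSup_le (hne x) ?_
    rintro _ ⟨n, z, hn, hz, rfl⟩
    obtain ⟨z', hz', -, hle⟩ := h.exists_transfer hN hz hxy
    have := le_csSup (hbdd y) ⟨n, z', hn, hz', rfl⟩
    linarith
  refine ⟨fun y => sSup (s y), fun y => ?_, fun N x y hN hxy =>
    abs_sub_le_iff.2 ⟨hle N x y hN hxy, hle N y x hN hxy.symm⟩⟩
  have : sSup (s y) ≤ sSup (s (shift y)) - φ y := by
    refine csSup_le (hne y) ?_
    rintro _ ⟨n, z, hn, hz, rfl⟩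
    -- A segment ending at y, prolonged by one step, competes in the supremum at σy.
    have := le_csSup (hbdd (shift y)) ⟨n + 1, z, by omega,
      by rw [Function.iterate_succ_apply', hz], rfl⟩
    rw [birkhoffSum_succ, hz] at this
    linarith
  linarith

theorem birkhoffSum_cohomologous (φ u : Subshift T → ℝ) (n : ℕ) (x : Subshift T) :
    birkhoffSum shift (fun y => φ y + u y - u (shift y)) n x =
      birkhoffSum shift φ n x + u x - u (shift^[n] x) := by
  induction n with
  | zero => simp
  | succ n ih =>
    rw [birkhoffSum_succ, birkhoffSum_succ, ih, Function.iterate_succ_apply']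
    ring

/-- A nonpositive continuous function with almost zero Birkhoff sums vanishes along an orbit. -/
theorem exists_orbit_eq_zero {B : Subshift T → ℝ} (hB : Continuous B) (hB0 : ∀ x, B x ≤ 0)
    (hx : ∀ (n : ℕ) (ε : ℝ), 0 < ε → ∃ x, -ε < birkhoffSum shift B n x) :
    ∃ x : Subshift T, ∀ i, B (shift^[i] x) = 0 := by
  have hcont : ∀ n, Continuous (birkhoffSum shift B n) := fun n =>
    continuous_finsetSum _ fun i _ => hB.comp (continuous_shift.iterate i)
  have hcl : ∀ n, IsClosed {x | 0 ≤ birkhoffSum shift B n x} := fun n =>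
    isClosed_le continuous_const (hcont n)
  have hne : ∀ n, {x | 0 ≤ birkhoffSum shift B n x}.Nonempty := by
    intro n
    obtain ⟨x0, -⟩ := hx 0 1 one_pos
    obtain ⟨x, -, hmax⟩ := isCompact_univ.exists_isMaxOn ⟨x0, Set.mem_univ _⟩
      (hcont n).continuousOn
    suffices h : 0 ≤ birkhoffSum shift B n x from ⟨x, h⟩
    refine le_of_forall_pos_lt_add fun ε hε => ?_
    obtain ⟨y, hy⟩ := hx n ε hε
    have : birkhoffSum shift B n y ≤ birkhoffSum shift B n x := hmax (Set.mem_univ y)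
    linarith
  -- The sets are nested because B ≤ 0: a nonnegative sum of n + 1 terms forces a nonnegative sum of
  -- n terms.
  obtain ⟨x, hx⟩ := IsCompact.nonempty_iInter_of_sequence_nonempty_isCompact_isClosed
    (fun n => {x | 0 ≤ birkhoffSum shift B n x})
    (fun n x hx => by
      have h1 : 0 ≤ birkhoffSum shift B (n + 1) x := hx
      rw [birkhoffSum_succ] at h1
      have : 0 ≤ birkhoffSum shift B n x := by linarith [hB0 (shift^[n] x)]
      exact this)
    hne (hcl 0).isCompact hcl
  refine ⟨x, fun i => le_antisymm (hB0 _) ?_⟩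
  have h1 : 0 ≤ birkhoffSum shift B (i + 1) x := Set.mem_iInter.1 hx (i + 1)
  have h2 : birkhoffSum shift B i x ≤ 0 := Finset.sum_nonpos fun j _ => hB0 _
  rw [birkhoffSum_succ] at h1
  linarith

section Subaction

variable {u : Subshift T → ℝ} {c : ℝ}

/-- A point near which orbit segments in the zero set of `φ + u - u ∘ σ` return has zero
self-action. -/
theorem IsExpHolder.action_self_of_returns (h : IsExpHolder φ H r)
    (hu : ∀ (N : ℕ) (x y : Subshift T), 0 < N → Agree N x y → |u x - u y| ≤ c * r ^ N)
    {x : Subshift T}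
    (hx : ∀ N : ℕ, ∃ (n : ℕ) (p : Subshift T), 0 < n ∧ Agree N p x ∧ Agree N (shift^[n] p) x ∧
      ∀ i, φ (shift^[i] p) + u (shift^[i] p) - u (shift (shift^[i] p)) = 0) :
    ActionGE φ x x 0 := by
  refine h.action_self_of_frequently fun N ε hN hε => ?_
  obtain ⟨N', hN1, hN2⟩ := (((h.tendsto c).eventually_lt_const hε).and
    (eventually_ge_atTop N)).exists
  obtain ⟨n, p, hn, hp, hp', hz⟩ := hx N'
  refine ⟨n, p, hn, hp.mono hN2, hp'.mono hN2, ?_⟩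
  have h1 := birkhoffSum_cohomologous φ u n p
  have h2 : birkhoffSum shift (fun y => φ y + u y - u (shift y)) n p = 0 :=
    Finset.sum_eq_zero fun i _ => hz i
  have h3 := (abs_le.1 (hu N' p _ (hN.trans_le hN2) (hp.trans hp'.symm))).2
  linarith

/-- A cluster point of the orbit works: two visits to the same cylinder delimit a returning segment
on which the sub-action is exact. -/
theorem IsExpHolder.exists_action_self (h : IsExpHolder φ H r)
    (hu : ∀ (N : ℕ) (x y : Subshift T), 0 < N → Agree N x y → |u x - u y| ≤ c * r ^ N)
    {x : Subshift T} (hx : ∀ i, φ (shift^[i] x) + u (shift^[i] x) - u (shift (shift^[i] x)) = 0) :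
    ∃ y : Subshift T, ActionGE φ y y 0 := by
  obtain ⟨y, hy⟩ := exists_clusterPt_of_compactSpace (map (fun n => shift^[n] x) atTop)
  refine ⟨y, h.action_self_of_returns hu fun N => ?_⟩
  have hf : ∃ᶠ n in atTop, Agree N (shift^[n] x) y :=
    (MapClusterPt.frequently (F := atTop) (u := fun n => shift^[n] x) hy
      ((isOpen_setOf_agree N y).mem_nhds (Agree.refl N y)))
  obtain ⟨n, hn⟩ := hf.exists
  obtain ⟨m, hm, hnm⟩ := (hf.and_eventually (eventually_gt_atTop n)).exists
  refine ⟨m - n, shift^[n] x, by omega, hn, ?_, fun i => ?_⟩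
  · rwa [← Function.iterate_add_apply, Nat.sub_add_cancel hnm.le]
  · rw [← Function.iterate_add_apply]
    exact hx _

end Subaction

end SFTMax

/-! ### Invariant measures, maximal mean and supports. -/

namespace SFTMax

variable {k : ℕ} {T : Fin k → Fin k → Prop}

theorem integrable_of_continuous {f : Subshift T → ℝ} (hf : Continuous f)
    (ν : Measure (Subshift T)) [IsFiniteMeasure ν] : Integrable f ν := by
  simpa using hf.continuousOn.integrableOn_compact (μ := ν) isCompact_univ

/-- The uniform measure on a periodic orbit. -/
theorem exists_isInvProb_of_periodic {n : ℕ} {p : Subshift T} (hn : 0 < n)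
    (hp : shift^[n] p = p) : ∃ ν : Measure (Subshift T), IsInvProb ν ∧
      ∀ f : Subshift T → ℝ, ∫ x, f x ∂ν = (n : ℝ)⁻¹ * birkhoffSum shift f n p := by
  have hn0 : (n : ℝ≥0∞) ≠ 0 := by exact_mod_cast hn.ne'
  set ν : Measure (Subshift T) :=
    (n : ℝ≥0∞)⁻¹ • ∑ i ∈ Finset.range n, Measure.dirac (shift^[i] p) with hν
  refine ⟨ν, ⟨⟨?_⟩, continuous_shift.measurable, ?_⟩, fun f => ?_⟩
  · simp [hν, ENNReal.inv_mul_cancel hn0]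
  · rw [hν, Measure.map_smul, Measure.map_finset_sum continuous_shift.measurable.aemeasurable]
    congr 1
    simp_rw [Measure.map_dirac' continuous_shift.measurable, ← Function.iterate_succ_apply']
    -- Pushing forward moves each Dirac mass one step along the orbit; the last lands on p and
    -- replaces the first.
    obtain ⟨n, rfl⟩ : ∃ m, n = m + 1 := ⟨n - 1, by omega⟩
    rw [Finset.sum_range_succ, Finset.sum_range_succ' _ n, hp]
    rfl
  · rw [hν, integral_smul_measure, integral_finsetSum_measure fun i _ => integrable_dirac (by simp)]
    simp [birkhoffSum]

theorem IsInvProb.integral_iterate {ν : Measure (Subshift T)} (hν : IsInvProb ν)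
    {f : Subshift T → ℝ} (hf : Continuous f) (n : ℕ) :
    ∫ x, f (shift^[n] x) ∂ν = ∫ x, f x ∂ν := by
  have h := hν.2.iterate n
  rw [← integral_map (f := f) h.measurable.aemeasurable hf.aestronglyMeasurable, h.map_eq]

theorem IsInvProb.exists_le_birkhoffSum {ν : Measure (Subshift T)} (hν : IsInvProb ν)
    {f : Subshift T → ℝ} (hf : Continuous f) (n : ℕ) :
    ∃ x, n * ∫ y, f y ∂ν ≤ birkhoffSum shift f n x := by
  have := hν.1
  have hi : ∀ i ∈ Finset.range n, Integrable (fun x => f (shift^[i] x)) ν := fun i _ =>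
    integrable_of_continuous (hf.comp (continuous_shift.iterate i)) ν
  obtain ⟨x, hx⟩ := exists_integral_le (μ := ν) (f := birkhoffSum shift f n)
    (integrable_finsetSum _ hi)
  refine ⟨x, le_trans (le_of_eq ?_) hx⟩
  simp_rw [birkhoffSum]
  rw [integral_finsetSum _ hi]
  simp [hν.integral_iterate hf]

theorem IsInvProb.integral_cohomologous {ν : Measure (Subshift T)} (hν : IsInvProb ν)
    {φ u : Subshift T → ℝ} (hφ : Continuous φ) (hu : Continuous u) :
    ∫ x, (φ x + u x - u (shift x)) ∂ν = ∫ x, φ x ∂ν := by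
  have := hν.1
  have h1 := integrable_of_continuous hφ ν
  have h2 := integrable_of_continuous hu ν
  have h3 : Integrable (fun x => u (shift x)) ν :=
    integrable_of_continuous (hu.comp continuous_shift) ν
  have h4 := hν.integral_iterate hu 1
  rw [integral_sub (f := fun x => φ x + u x) (h1.add h2) h3, integral_add h1 h2]
  simp only [Function.iterate_one] at h4
  simp [h4]

theorem integral_le_of_forall_le {ν : Measure (Subshift T)} (hν : IsInvProb ν)
    {f : Subshift T → ℝ} (hf : Continuous f) {c : ℝ} (hc : ∀ x, f x ≤ c) : ∫ x, f x ∂ν ≤ c := by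
  have := hν.1
  simpa using integral_mono (integrable_of_continuous hf ν) (integrable_const c) hc

theorem bddAbove_integrals {A : Subshift T → ℝ} (hA : Continuous A) :
    BddAbove {t : ℝ | ∃ ν : Measure (Subshift T), IsInvProb ν ∧ ∫ x, A x ∂ν = t} := by
  obtain ⟨c, hc⟩ := (isCompact_range hA).bddAbove
  refine ⟨c, ?_⟩
  rintro _ ⟨ν, hν, rfl⟩
  exact integral_le_of_forall_le hν hA fun x => hc ⟨x, rfl⟩

theorem IsInvProb.integral_le_maxMean {ν : Measure (Subshift T)} (hν : IsInvProb ν)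
    {A : Subshift T → ℝ} (hA : Continuous A) : ∫ x, A x ∂ν ≤ maxMean A :=
  le_csSup (bddAbove_integrals hA) ⟨ν, hν, rfl⟩

theorem exists_integral_gt {A : Subshift T → ℝ}
    (hne : ∃ ν : Measure (Subshift T), IsInvProb ν) {ε : ℝ} (hε : 0 < ε) :
    ∃ ν : Measure (Subshift T), IsInvProb ν ∧ maxMean A - ε < ∫ x, A x ∂ν := by
  obtain ⟨ν₀, hν₀⟩ := hne
  obtain ⟨_, ⟨ν, hν, rfl⟩, h⟩ := exists_lt_of_lt_csSup
    (s := {t : ℝ | ∃ ν : Measure (Subshift T), IsInvProb ν ∧ ∫ x, A x ∂ν = t})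
    ⟨_, ν₀, hν₀, rfl⟩ (sub_lt_self (maxMean A) hε)
  exact ⟨ν, hν, h⟩

theorem birkhoffSum_sub_maxMean_nonpos {A : Subshift T → ℝ} (hA : Continuous A) {n : ℕ}
    {p : Subshift T} (hn : 0 < n) (hp : shift^[n] p = p) :
    birkhoffSum shift (fun x => A x - maxMean A) n p ≤ 0 := by
  obtain ⟨ν, hν, hint⟩ := exists_isInvProb_of_periodic hn hp
  have h1 := hν.integral_le_maxMean hA
  have h0 : (0 : ℝ) < n := by exact_mod_cast hn
  rw [hint, inv_mul_le_iff₀ h0] at h1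
  simp only [birkhoffSum] at h1 ⊢
  simp [Finset.sum_sub_distrib]
  linarith

/-- The mean m lies within the range of oscillation of A. Bounding φ itself by the Hölder constant
makes all later estimates proportional to it. -/
theorem abs_sub_maxMean_le {A : Subshift T → ℝ} (hA : Continuous A)
    (hne : ∃ ν : Measure (Subshift T), IsInvProb ν) {H : ℝ} (hH : ∀ x y, |A x - A y| ≤ H)
    (x : Subshift T) : |A x - maxMean A| ≤ H := by
  obtain ⟨ν₀, hν₀⟩ := hne
  refine abs_sub_le_iff.2 ⟨?_, ?_⟩
  · have h1 := integral_le_of_forall_le hν₀ hA.neg (c := H - A x)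
      fun y => by
        have := (abs_le.1 (hH x y)).2
        simp only [Pi.neg_apply]
        linarith
    simp only [Pi.neg_apply, integral_neg] at h1
    linarith [hν₀.integral_le_maxMean hA]
  · rw [sub_le_iff_le_add]
    refine csSup_le ⟨_, ν₀, hν₀, rfl⟩ ?_
    rintro _ ⟨ν, hν, rfl⟩
    exact integral_le_of_forall_le hν hA fun y => by linarith [(abs_le.1 (hH y x)).2]

theorem IsInvProb.shift_mem_support {μ : Measure (Subshift T)} (hμ : IsInvProb μ)
    {x : Subshift T} (hx : x ∈ μ.support) : shift x ∈ μ.support := by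
  rw [Measure.mem_support_iff_forall] at hx ⊢
  intro U hU
  have h1 := hx _ (continuous_shift.continuousAt.preimage_mem_nhds (mem_interior_iff_mem_nhds.2 hU
    |> isOpen_interior.mem_nhds))
  rw [hμ.2.measure_preimage isOpen_interior.measurableSet.nullMeasurableSet] at h1
  exact h1.trans_le (measure_mono interior_subset)

theorem IsInvProb.iterate_mem_support {μ : Measure (Subshift T)} (hμ : IsInvProb μ)
    {x : Subshift T} (hx : x ∈ μ.support) (n : ℕ) : shift^[n] x ∈ μ.support := by
  induction n with
  | zero => exact hx
  | succ n ih =>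
    rw [Function.iterate_succ_apply']
    exact hμ.shift_mem_support ih

/-- Poincaré recurrence for the cylinder cut down to the support, which has full measure; so the
returning point can be taken in the support. -/
theorem IsInvProb.exists_return {μ : Measure (Subshift T)} (hμ : IsInvProb μ)
    {x : Subshift T} (hx : x ∈ μ.support) (N : ℕ) : ∃ (n : ℕ) (p : Subshift T),
      0 < n ∧ p ∈ μ.support ∧ Agree N p x ∧ Agree N (shift^[n] p) x := by
  have := hμ.1
  have ho := isOpen_setOf_agree N x
  have hpos : μ ({y | Agree N y x} ∩ μ.support) ≠ 0 := by
    rw [measure_inter_conull' (measure_mono_null (Set.sdiff_subset_compl _ _)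
      Measure.measure_compl_support)]
    exact ((Measure.mem_support_iff_forall x).1 hx _ (ho.mem_nhds (Agree.refl N x))).ne'
  obtain ⟨p, hp, n, hn, hp'⟩ := hμ.2.conservative.exists_mem_iterate_mem
    (ho.measurableSet.inter Measure.isClosed_support.measurableSet).nullMeasurableSet hpos
  exact ⟨n, p, Nat.pos_of_ne_zero hn, hp.2, hp.1, hp'.1⟩

theorem eq_zero_on_support {μ : Measure (Subshift T)} (hμ : IsInvProb μ) {B : Subshift T → ℝ}
    (hB : Continuous B) (hB0 : ∀ x, B x ≤ 0) (hint : ∫ x, B x ∂μ = 0) {x : Subshift T}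
    (hx : x ∈ μ.support) : B x = 0 := by
  have := hμ.1
  have h1 : ∫ x, -B x ∂μ = 0 := by rw [integral_neg, hint, neg_zero]
  rw [integral_eq_zero_iff_of_nonneg (fun x => neg_nonneg.2 (hB0 x))
    (integrable_of_continuous hB.neg μ)] at h1
  have hcl : IsClosed {x | B x = 0} := isClosed_eq hB continuous_const
  refine Measure.support_subset_of_isClosed hcl ?_ hx
  filter_upwards [h1] with y hy
  simpa using hy

theorem integral_eq_zero_of_support {μ : Measure (Subshift T)} {B : Subshift T → ℝ}
    (h : ∀ x ∈ μ.support, B x = 0) : ∫ x, B x ∂μ = 0 := by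
  refine integral_eq_zero_of_ae ?_
  filter_upwards [Measure.support_mem_ae (μ := μ)] with x hx using h x hx

/-- The support of a maximizing measure consists of points of zero self-action. -/
theorem IsMaximizing.action_self {A : Subshift T → ℝ} {H r c : ℝ} {u : Subshift T → ℝ}
    (hA : Continuous A) (h : IsExpHolder (fun x => A x - maxMean A) H r)
    (hu0 : ∀ y, A y - maxMean A + u y - u (shift y) ≤ 0)
    (hu : ∀ (N : ℕ) (x y : Subshift T), 0 < N → Agree N x y → |u x - u y| ≤ c * r ^ N)
    {μ : Measure (Subshift T)} (hμ : IsMaximizing A μ) {x : Subshift T} (hx : x ∈ μ.support) :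
    ActionGE (fun x => A x - maxMean A) x x 0 := by
  have := hμ.1.1
  have huc := continuous_of_agree h.pos.le h.lt_one hu
  have hint := hμ.1.integral_cohomologous h.continuous huc
  rw [integral_sub (integrable_of_continuous hA μ) (integrable_const _), hμ.2] at hint
  refine h.action_self_of_returns hu fun N => ?_
  obtain ⟨n, p, hn, hp, hpx, hpx'⟩ := hμ.1.exists_return hx N
  exact ⟨n, p, hn, hpx, hpx', fun i => eq_zero_on_support hμ.1
    ((h.continuous.add huc).sub (huc.comp continuous_shift)) hu0 (by simpa using hint)
    (hμ.1.iterate_mem_support hp i)⟩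

theorem exists_action_self_of_subaction {A : Subshift T → ℝ} {H r c : ℝ} {u : Subshift T → ℝ}
    (hne : ∃ ν : Measure (Subshift T), IsInvProb ν)
    (hA : Continuous A) (h : IsExpHolder (fun x => A x - maxMean A) H r)
    (hu0 : ∀ y, A y - maxMean A + u y - u (shift y) ≤ 0)
    (hu : ∀ (N : ℕ) (x y : Subshift T), 0 < N → Agree N x y → |u x - u y| ≤ c * r ^ N) :
    ∃ x, ActionGE (fun x => A x - maxMean A) x x 0 := by
  have huc := continuous_of_agree h.pos.le h.lt_one hu
  have hB : Continuous fun y => A y - maxMean A + u y - u (shift y) :=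
    (h.continuous.add huc).sub (huc.comp continuous_shift)
  obtain ⟨x, hx⟩ := exists_orbit_eq_zero hB hu0 fun n ε hε => by
    -- A mean within ε/(n+1) of m gives some sum of n terms above -ε, so nearly maximizing measures
    -- suffice.
    obtain ⟨ν, hν, hlt⟩ := exists_integral_gt (A := A) hne (ε := ε / (n + 1)) (by positivity)
    have := hν.1
    obtain ⟨x, hx⟩ := hν.exists_le_birkhoffSum hB n
    refine ⟨x, lt_of_lt_of_le ?_ hx⟩
    rw [hν.integral_cohomologous h.continuous huc,
      integral_sub (integrable_of_continuous hA ν) (integrable_const _)]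
    simp only [integral_const, probReal_univ, one_smul]
    have h0 : (0 : ℝ) < n + 1 := by positivity
    have h1 : -(ε / (n + 1)) < ∫ x, A x ∂ν - maxMean A := by linarith
    have h2 := mul_le_mul_of_nonneg_left h1.le (Nat.cast_nonneg (α := ℝ) n)
    have h3 : (n : ℝ) * -(ε / (n + 1)) = -ε + ε / (n + 1) := by field_simp; ring
    have h4 : 0 < ε / (n + 1) := by positivity
    linarith
  exact h.exists_action_self hu hx

end SFTMax

/-! ### From cylinders back to the metric and the extended reals. -/

namespace SFTMax

variable {k : ℕ} {T : Fin k → Fin k → Prop} {lam α : ℝ}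

theorem agree_firstDiff (x y : Subshift T) : Agree (PiNat.firstDiff x.1 y.1) x y :=
  fun _ hi => PiNat.apply_eq_of_lt_firstDiff hi

theorem Agree.le_firstDiff {N : ℕ} {x y : Subshift T} (h : Agree N x y) (hxy : x ≠ y) :
    N ≤ PiNat.firstDiff x.1 y.1 := by
  by_contra! hlt
  exact PiNat.apply_firstDiff_ne (fun e => hxy (Subtype.ext e)) (h _ hlt)

theorem symDist_of_ne {x y : Subshift T} (hxy : x ≠ y) :
    symDist lam x y = (lam ^ PiNat.firstDiff x.1 y.1)⁻¹ := if_neg hxy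

theorem symDist_self (x : Subshift T) : symDist lam x x = 0 := if_pos rfl

theorem symDist_le_iff (hlam : 1 < lam) {N : ℕ} {x y : Subshift T} :
    symDist lam x y ≤ (lam ^ N)⁻¹ ↔ Agree N x y := by
  have h0 : 0 < lam := by linarith
  by_cases hxy : x = y
  · subst hxy
    simp only [symDist_self, Agree.refl, iff_true]
    positivity
  · rw [symDist_of_ne hxy, inv_le_inv₀ (pow_pos h0 _) (pow_pos h0 _),
      pow_le_pow_iff_right₀ hlam]
    exact ⟨fun h => (agree_firstDiff x y).mono h, fun h => h.le_firstDiff hxy⟩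

theorem symDist_rpow (hlam : 1 < lam) {x y : Subshift T} (hxy : x ≠ y) :
    symDist lam x y ^ α = (lam ^ α)⁻¹ ^ PiNat.firstDiff x.1 y.1 := by
  have h0 : 0 ≤ lam := by linarith
  rw [symDist_of_ne hxy, Real.inv_rpow (pow_nonneg h0 _), ← Real.rpow_natCast, inv_pow,
    ← Real.rpow_natCast, ← Real.rpow_mul h0, ← Real.rpow_mul h0, mul_comm]

theorem rate_pos (hlam : 1 < lam) : 0 < (lam ^ α)⁻¹ :=
  inv_pos.2 (Real.rpow_pos_of_pos (by linarith) _)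

theorem rate_lt_one (hlam : 1 < lam) (hα : 0 < α) : (lam ^ α)⁻¹ < 1 :=
  inv_lt_one_of_one_lt₀ (Real.one_lt_rpow hlam hα)

theorem IsHolder.bound (hlam : 1 < lam) (hα : 0 < α) {A : Subshift T → ℝ}
    (hA : IsHolder lam α A) {N : ℕ} {x y : Subshift T} (hxy : Agree N x y) :
    |A x - A y| ≤ (hold lam α A).toReal * (lam ^ α)⁻¹ ^ N := by
  have hr := rate_pos (α := α) hlam
  by_cases hne : x = y
  · simp only [hne, sub_self, abs_zero]
    positivity
  · have hd : 0 < symDist lam x y := by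
      rw [symDist_of_ne hne]
      have : 0 < lam := by linarith
      positivity
    have hd1 : symDist lam x y ≤ 1 := by
      simpa using (symDist_le_iff hlam (N := 0)).2 (fun i hi => absurd hi (by omega))
    have h1 : ENNReal.ofReal (|A x - A y| / symDist lam x y ^ α) ≤ hold lam α A :=
      le_iSup_of_le x (le_iSup_of_le y (le_iSup_of_le ⟨hd, hd1⟩ le_rfl))
    rw [ENNReal.ofReal_le_iff_le_toReal hA.ne, div_le_iff₀ (Real.rpow_pos_of_pos hd _),
      symDist_rpow hlam hne] at h1
    exact h1.trans (mul_le_mul_of_nonneg_left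
      (pow_le_pow_of_le_one hr.le (rate_lt_one hlam hα).le (hxy.le_firstDiff hne))
      ENNReal.toReal_nonneg)

/-- Used with `N₀ = 0` for the full Hölder constant, and with `N₀ = 1` for pairs sharing a first
symbol, where gluing applies and no gap is needed. -/
theorem holdUpTo_le (hlam : 1 < lam) {f : Subshift T → ℝ} {c : ℝ} {N₀ : ℕ}
    (hf : ∀ (N : ℕ) (x y : Subshift T), N₀ ≤ N → Agree N x y →
      |f x - f y| ≤ c * (lam ^ α)⁻¹ ^ N) :
    holdUpTo lam α (lam ^ N₀)⁻¹ f ≤ ENNReal.ofReal c := by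
  refine iSup_le fun x => iSup_le fun y => iSup_le fun ⟨h0, h1⟩ => ?_
  have hne : x ≠ y := by
    rintro rfl
    exact h0.ne' (symDist_self x)
  refine ENNReal.ofReal_le_ofReal ?_
  rw [div_le_iff₀ (Real.rpow_pos_of_pos h0 _), symDist_rpow hlam hne]
  exact hf _ x y (((symDist_le_iff hlam).1 h1).le_firstDiff hne) (agree_firstDiff x y)

theorem IsHolder.of_bound (hlam : 1 < lam) {f : Subshift T → ℝ} {c : ℝ}
    (hf : ∀ (N : ℕ) (x y : Subshift T), Agree N x y → |f x - f y| ≤ c * (lam ^ α)⁻¹ ^ N) :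
    IsHolder lam α f := by
  have := holdUpTo_le hlam (N₀ := 0) fun N x y _ => hf N x y
  rw [pow_zero, inv_one] at this
  exact this.trans_lt ENNReal.ofReal_lt_top

/-- The bridge that lets every statement on the action potential be proved with real numbers and
cylinders. -/
theorem coe_le_action_iff (hlam : 1 < lam) {A : Subshift T → ℝ} {x y : Subshift T} {c : ℝ} :
    (c : EReal) ≤ action lam A x y ↔ ActionGE (fun x => A x - maxMean A) x y c := by
  have h0 : 0 < lam := by linarith
  constructor
  · intro h c' hc' M
    have h1 : (c' : EReal) < actionAt lam A (lam ^ M)⁻¹ x y :=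
      (EReal.coe_lt_coe_iff.2 hc').trans_le
        (h.trans (iInf₂_le (lam ^ M)⁻¹ (inv_pos.2 (pow_pos h0 M))))
    simp only [actionAt, lt_iSup_iff] at h1
    obtain ⟨n, z, ⟨hn, hz, hzx⟩, hlt⟩ := h1
    exact ⟨n, z, hn, hz, (symDist_le_iff hlam).1 hzx.le, EReal.coe_lt_coe_iff.1 hlt⟩
  · intro h
    refine le_iInf₂ fun δ hδ => le_of_forall_lt fun e he => ?_
    obtain ⟨c', h1, h2⟩ := EReal.lt_iff_exists_real_btwn.1 he
    obtain ⟨M, hM⟩ := exists_pow_lt_of_lt_one hδ (inv_lt_one_of_one_lt₀ hlam)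
    obtain ⟨n, z, hn, hz, hzx, hlt⟩ := h c' (EReal.coe_lt_coe_iff.1 h2) M
    rw [inv_pow] at hM
    exact h1.trans ((EReal.coe_lt_coe_iff.2 hlt).trans_le
      (le_iSup_of_le n (le_iSup_of_le z
        (le_iSup_of_le ⟨hn, hz, ((symDist_le_iff hlam).2 hzx).trans_lt hM⟩ le_rfl))))

theorem actionAt_le {A : Subshift T → ℝ} {Q : ℝ}
    (hQ : ∀ (n : ℕ) (z : Subshift T), birkhoffSum shift (fun x => A x - maxMean A) n z ≤ Q)
    (δ : ℝ) (x y : Subshift T) : actionAt lam A δ x y ≤ Q :=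
  iSup_le fun n => iSup_le fun z => iSup_le fun _ => EReal.coe_le_coe_iff.2 (hQ n z)

theorem action_le {A : Subshift T → ℝ} {Q : ℝ}
    (hQ : ∀ (n : ℕ) (z : Subshift T), birkhoffSum shift (fun x => A x - maxMean A) n z ≤ Q)
    (x y : Subshift T) : action lam A x y ≤ Q :=
  (iInf₂_le 1 one_pos).trans (actionAt_le hQ 1 x y)

theorem exists_isInvProb (hne : Nonempty (Subshift T)) (hT : IsTopMixing T) :
    ∃ ν : Measure (Subshift T), IsInvProb ν := by
  obtain ⟨g, hg, hgap⟩ := hT.exists_gap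
  obtain ⟨x⟩ := hne
  obtain ⟨z, hz, hzx⟩ := hgap x x
  obtain ⟨p, hp, -⟩ := exists_periodic hg Nat.one_pos (hzx ▸ hz.symm)
  obtain ⟨ν, hν, -⟩ := exists_isInvProb_of_periodic hg hp
  exact ⟨ν, hν⟩

/-- A closed set that carries precisely the maximizing measures is uniquely ergodic as soon as the
maximizing measure is unique. -/
theorem uniquelyErgodicOn_of_existsUnique {A : Subshift T → ℝ} {K : Set (Subshift T)}
    (hK : IsClosed K) (h : ∃! μ : Measure (Subshift T), IsMaximizing A μ)
    (h1 : ∀ μ : Measure (Subshift T), IsMaximizing A μ → μ.support ⊆ K)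
    (h2 : ∀ ν : Measure (Subshift T), IsInvProb ν → ν.support ⊆ K → IsMaximizing A ν) :
    UniquelyErgodicOn K := by
  obtain ⟨μ, hμ, huniq⟩ := h
  refine ⟨μ, ⟨hμ.1, measure_mono_null (Set.compl_subset_compl.2 (h1 μ hμ))
    Measure.measure_compl_support⟩, fun ν hν => huniq ν (h2 ν hν.1 ?_)⟩
  exact Measure.support_subset_of_isClosed hK (mem_ae_iff.2 hν.2)

end SFTMax

/-! ### Assembly of the theorem. -/

theorem mainTheorem7 (lam α : ℝ) (hlam : 1 < lam) (hα0 : 0 < α) (hα1 : α ≤ 1) :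
    -- `C₀` depends on `lam` and `α` only, `C` on `lam`, `α` and the subshift.
    ∃ C₀ : ℝ≥0, ∀ (k : ℕ) (T : Fin k → Fin k → Prop),
      Nonempty (Subshift T) → IsTopMixing T →
      ∃ C : ℝ≥0, ∀ A : Subshift T → ℝ, IsHolder lam α A →
        -- The action potential is bounded above.
        (∃ Q : ℝ, 0 < Q ∧ ∀ (x y : Subshift T) (δ : ℝ), 0 < δ → actionAt lam A δ x y < (Q : EReal)) ∧
        (∀ x : Subshift T, action lam A x x ≤ 0) ∧
        -- Triangle inequality.
        (∀ x y z : Subshift T, action lam A x y + action lam A y z ≤ action lam A x z) ∧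
        -- The set `𝔖` and the maximizing measures.
        IsClosed (zeroSet lam A) ∧
        Set.MapsTo shift (zeroSet lam A) (zeroSet lam A) ∧
        (∀ μ : Measure (Subshift T), IsInvProb μ →
          (IsMaximizing A μ ↔ μ.support ⊆ zeroSet lam A)) ∧
        (zeroSet lam A).Nonempty ∧
        -- For `x ∈ 𝔖` the function `W = S(x, ·)` and the function `B = A - m(A) + W - W ∘ σ`.
        (∀ x ∈ zeroSet lam A, ∃ W : Subshift T → ℝ,
          (∀ y, action lam A x y = (W y : EReal)) ∧
          IsHolder lam α W ∧
          hold lam α W ≤ C * hold lam α A ∧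
          holdUpTo lam α lam⁻¹ W ≤ C₀ * hold lam α A ∧
          (∀ y z, action lam A y z ≤ ((W z - W y : ℝ) : EReal)) ∧
          ∃ B : Subshift T → ℝ,
            (∀ y, B y = A y - maxMean A + W y - W (shift y)) ∧
            IsHolder lam α B ∧
            (∀ y, B y ≤ 0) ∧
            (∀ ν : Measure (Subshift T), IsInvProb ν →
              ∫ y, B y ∂ν = ∫ y, A y ∂ν - maxMean A) ∧
            (∀ μ : Measure (Subshift T), IsMaximizing A μ → ∫ y, B y ∂μ = 0) ∧
            (∀ y ∈ zeroSet lam A, B y = 0) ∧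
            (∀ μ : Measure (Subshift T), IsMaximizing A μ → ∀ y ∈ μ.support, B y = 0)) ∧
        -- Measures carried by the support of a maximizing measure; unique ergodicity.
        (∀ μ : Measure (Subshift T), IsMaximizing A μ →
          ∀ ν : Measure (Subshift T), IsInvProb ν → ν.support ⊆ μ.support → IsMaximizing A ν) ∧
        ((∃! μ : Measure (Subshift T), IsMaximizing A μ) →
          UniquelyErgodicOn (zeroSet lam A) ∧
          ∀ μ : Measure (Subshift T), IsMaximizing A μ → UniquelyErgodicOn μ.support) := by
  set r : ℝ := (lam ^ α)⁻¹ with hr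
  have hr0 : 0 < r := rate_pos hlam
  have hr1 : r < 1 := rate_lt_one hlam hα0
  have hK0 : 0 ≤ (1 - r)⁻¹ := inv_nonneg.2 (sub_nonneg.2 hr1.le)
  -- The local constant is pure distortion, hence independent of the subshift.
  refine ⟨(1 - r)⁻¹.toNNReal, fun k T hne hT => ?_⟩
  obtain ⟨g, hg, hgap⟩ := hT.exists_gap
  -- Globally W lies in [-Q, Q], so its oscillation is at most 2Q; the gap g is where the subshift
  -- enters.
  refine ⟨(2 * ((1 - r)⁻¹ + g)).toNNReal, fun A hA => ?_⟩
  have hinv := exists_isInvProb hne hT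
  set H : ℝ := (hold lam α A).toReal with hH
  have hH0 : 0 ≤ H := ENNReal.toReal_nonneg
  have hHof : ENNReal.ofReal H = hold lam α A := ENNReal.ofReal_toReal hA.ne
  have hh : IsExpHolder (fun x => A x - maxMean A) H r :=
    ⟨hr0, hr1, hH0, fun N x y hxy => by
      rw [sub_sub_sub_cancel_right]
      exact hA.bound hlam hα0 hxy⟩
  have hAc : Continuous A := by
    simpa [Pi.add_def] using hh.continuous.add (continuous_const (y := maxMean A))
  have hb : ∀ x, |A x - maxMean A| ≤ H := abs_sub_maxMean_le hAc hinv fun x y => by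
    simpa using hA.bound hlam hα0 (N := 0) (x := x) (y := y) fun i hi => absurd hi (by omega)
  have hper : ∀ (n : ℕ) (p : Subshift T), 0 < n → shift^[n] p = p →
      birkhoffSum shift (fun x => A x - maxMean A) n p ≤ 0 :=
    fun n p hn hp => birkhoffSum_sub_maxMean_nonpos hAc hn hp
  have hQ := hh.birkhoffSum_le hb hper hg hgap
  set Q : ℝ := H * ((1 - r)⁻¹ + g) with hQdef
  have hQ0 : 0 ≤ Q := by positivity
  obtain ⟨u, hu0, hu⟩ := hh.exists_subaction hQ fun y =>
    ⟨g, _, hg, (hgap y y).choose_spec.2⟩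
  have hself : ∀ x : Subshift T, action lam A x x ≤ 0 := fun x => by
    refine EReal.ge_of_forall_gt_iff_ge.1 fun c hc => ?_
    exact EReal.coe_le_coe_iff.2 (hh.action_self_le hper ((coe_le_action_iff hlam).1 hc.le))
  have htri : ∀ x y z : Subshift T,
      action lam A x y + action lam A y z ≤ action lam A x z := by
    intro x y z
    -- With ⊤ excluded and ⊥ absorbing, only the sum of two real values remains.
    have h1 : ∀ x y : Subshift T, action lam A x y ≠ ⊤ := fun x y =>
      ((action_le hQ x y).trans_lt (EReal.coe_lt_top _)).ne
    by_cases hxy : action lam A x y = ⊥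
    · simp [hxy]
    by_cases hyz : action lam A y z = ⊥
    · simp [hyz]
    rw [← EReal.coe_toReal (h1 x y) hxy, ← EReal.coe_toReal (h1 y z) hyz, ← EReal.coe_add,
      coe_le_action_iff hlam]
    exact hh.action_triangle
      ((coe_le_action_iff hlam).1 (EReal.coe_toReal (h1 x y) hxy).le)
      ((coe_le_action_iff hlam).1 (EReal.coe_toReal (h1 y z) hyz).le)
  have hmem : ∀ x : Subshift T, x ∈ zeroSet lam A ↔
      ActionGE (fun x => A x - maxMean A) x x 0 := fun x => by
    rw [← coe_le_action_iff hlam, EReal.coe_zero]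
    exact ⟨fun h => (Eq.symm h).le, fun h => le_antisymm (hself x) h⟩
  have hclosed : IsClosed (zeroSet lam A) := by
    rw [Set.ext hmem]
    exact hh.isClosed_action_self
  have hnonempty : (zeroSet lam A).Nonempty := by
    obtain ⟨x, hx⟩ := exists_action_self_of_subaction hinv hAc hh hu0 hu
    exact ⟨x, (hmem x).2 hx⟩
  have hsupp : ∀ μ : Measure (Subshift T), IsMaximizing A μ → μ.support ⊆ zeroSet lam A :=
    fun μ hμ x hx => (hmem x).2 (hμ.action_self hAc hh hu0 hu hx)
  have hW : ∀ x ∈ zeroSet lam A, ∃ W : Subshift T → ℝ,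
          (∀ y, action lam A x y = (W y : EReal)) ∧
          IsHolder lam α W ∧
          hold lam α W ≤ (2 * ((1 - r)⁻¹ + g)).toNNReal * hold lam α A ∧
          holdUpTo lam α lam⁻¹ W ≤ (1 - r)⁻¹.toNNReal * hold lam α A ∧
          (∀ y z, action lam A y z ≤ ((W z - W y : ℝ) : EReal)) ∧
          ∃ B : Subshift T → ℝ,
            (∀ y, B y = A y - maxMean A + W y - W (shift y)) ∧
            IsHolder lam α B ∧
            (∀ y, B y ≤ 0) ∧
            (∀ ν : Measure (Subshift T), IsInvProb ν →
              ∫ y, B y ∂ν = ∫ y, A y ∂ν - maxMean A) ∧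
            (∀ μ : Measure (Subshift T), IsMaximizing A μ → ∫ y, B y ∂μ = 0) ∧
            (∀ y ∈ zeroSet lam A, B y = 0) ∧
            (∀ μ : Measure (Subshift T), IsMaximizing A μ → ∀ y ∈ μ.support, B y = 0) := by
    intro x hx
    have hx' := (hmem x).1 hx
    have hlow := fun y => hh.action_lower_bound hb hg hgap hx' y
    have hWeq : ∀ y, action lam A x y = ((action lam A x y).toReal : EReal) := fun y =>
      (EReal.coe_toReal ((action_le hQ x y).trans_lt (EReal.coe_lt_top _)).ne
        ((EReal.bot_lt_coe _).trans_le ((coe_le_action_iff hlam).2 (hlow y))).ne').symm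
    generalize hWdef : (fun y => (action lam A x y).toReal) = W
    replace hWeq : ∀ y, action lam A x y = (W y : EReal) := by subst hWdef; exact hWeq
    have hWge : ∀ y c, ActionGE (fun x => A x - maxMean A) x y c ↔ c ≤ W y := fun y c => by
      rw [← coe_le_action_iff hlam, hWeq, EReal.coe_le_coe_iff]
    have hWact := fun y => (hWge y _).2 le_rfl
    have hWnear : ∀ (N : ℕ) (y z : Subshift T), 0 < N → Agree N y z →
        |W y - W z| ≤ H * (1 - r)⁻¹ * r ^ N := fun N y z hN hyz => by
      have h1 := (hWge z _).1 (hh.action_transfer hx' (hWact y) hN hyz)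
      have h2 := (hWge y _).1 (hh.action_transfer hx' (hWact z) hN hyz.symm)
      exact abs_sub_le_iff.2 ⟨by linarith, by linarith⟩
    have hWall : ∀ (N : ℕ) (y z : Subshift T), Agree N y z → |W y - W z| ≤ 2 * Q * r ^ N := by
      intro N y z hyz
      rcases Nat.eq_zero_or_pos N with rfl | hN
      · have h1 := fun y => (hWge y _).1 (hlow y)
        have h2 := fun y => (hWact y).le_of_birkhoffSum_le hQ
        rw [pow_zero]
        exact abs_sub_le_iff.2 ⟨by linarith [h1 y, h1 z, h2 y, h2 z],
          by linarith [h1 y, h1 z, h2 y, h2 z]⟩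
      · refine (hWnear N y z hN hyz).trans (mul_le_mul_of_nonneg_right ?_ (by positivity))
        have : 0 ≤ H * g := by positivity
        have : 0 ≤ H * (1 - r)⁻¹ := by positivity
        rw [hQdef]
        linarith
    have hWstep : ∀ y z c, ActionGE (fun x => A x - maxMean A) y z c → W y + c ≤ W z :=
      fun y z c hc => (hWge z _).1 (hh.action_triangle (hWact y) hc)
    have hWc : Continuous W := continuous_of_agree hr0.le hr1 hWnear
    have hBint : ∀ ν : Measure (Subshift T), IsInvProb ν →
        ∫ y, (A y - maxMean A + W y - W (shift y)) ∂ν = ∫ y, A y ∂ν - maxMean A := by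
      intro ν hν
      have := hν.1
      rw [hν.integral_cohomologous hh.continuous hWc,
        integral_sub (integrable_of_continuous hAc ν) (integrable_const _)]
      simp
    have hB0 : ∀ y ∈ zeroSet lam A, A y - maxMean A + W y - W (shift y) = 0 := by
      intro y hy
      -- Going from y to σy and back gives the two opposite inequalities.
      have h1 := hWstep _ _ _ (IsExpHolder.action_shift (fun x => A x - maxMean A) y)
      have h2 := hWstep _ _ _ (hh.action_shift_self ((hmem y).1 hy))
      linarith
    refine ⟨W, hWeq, .of_bound hlam hWall, ?_, ?_, ?_,
      fun y => A y - maxMean A + W y - W (shift y), fun _ => rfl,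
      .of_bound hlam (c := H + 2 * Q + 2 * Q * r⁻¹) ?_, fun y => ?_, hBint,
      fun μ hμ => by rw [hBint μ hμ.1, hμ.2, sub_self], hB0,
      fun μ hμ y hy => hB0 y (hsupp μ hμ hy)⟩
    · have h1 := holdUpTo_le hlam (N₀ := 0) fun N y z _ => hWall N y z
      rw [pow_zero, inv_one, hQdef, mul_left_comm, mul_comm, ENNReal.ofReal_mul (by positivity),
        hHof] at h1
      exact h1
    · have h1 := holdUpTo_le hlam (N₀ := 1) fun N y z hN => hWnear N y z hN
      rw [pow_one, mul_comm, ENNReal.ofReal_mul hK0, hHof] at h1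
      exact h1
    · intro y z
      refine EReal.ge_of_forall_gt_iff_ge.1 fun c hc => EReal.coe_le_coe_iff.2 ?_
      linarith [hWstep y z c ((coe_le_action_iff hlam).1 hc.le)]
    · intro N y z hyz
      have h1 := abs_le.1 (hA.bound hlam hα0 hyz)
      have h2 := abs_le.1 (hWall N y z hyz)
      -- The shift loses one symbol of agreement, whence the factor r⁻¹; with `N = 0` there is none
      -- to lose.
      have h3 : |W (shift y) - W (shift z)| ≤ 2 * Q * r⁻¹ * r ^ N := by
        rcases N with _ | N
        · refine (hWall 0 (shift y) (shift z) fun i hi => absurd hi (by omega)).trans ?_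
          simp only [pow_zero, mul_one]
          exact le_mul_of_one_le_right (by positivity) ((one_le_inv₀ hr0).2 hr1.le)
        · refine (hWall N _ _ (Agree.shift hyz)).trans (le_of_eq ?_)
          rw [pow_succ']
          field_simp
      have h3' := abs_le.1 h3
      rw [add_mul, add_mul]
      exact abs_le.2 ⟨by linarith [h1.1, h2.1, h3'.2], by linarith [h1.2, h2.2, h3'.1]⟩
    · linarith [hWstep _ _ _ (IsExpHolder.action_shift (fun x => A x - maxMean A) y)]
  have hmax : ∀ μ : Measure (Subshift T), IsInvProb μ →
      (IsMaximizing A μ ↔ μ.support ⊆ zeroSet lam A) := by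
    refine fun μ hμ => ⟨hsupp μ, fun h => ⟨hμ, ?_⟩⟩
    -- Any base point of 𝔖 will do, since its B vanishes on all of 𝔖.
    obtain ⟨x, hx⟩ := hnonempty
    obtain ⟨W, -, -, -, -, -, B, -, -, -, hB, -, hB0, -⟩ := hW x hx
    have h1 := hB μ hμ
    rw [integral_eq_zero_of_support fun y hy => hB0 y (h hy)] at h1
    linarith
  have hsub : ∀ μ : Measure (Subshift T), IsMaximizing A μ → ∀ ν : Measure (Subshift T),
      IsInvProb ν → ν.support ⊆ μ.support → IsMaximizing A ν :=
    fun μ hμ ν hν h => (hmax ν hν).2 (h.trans (hsupp μ hμ))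
  refine ⟨⟨Q + 1, by positivity, fun x y δ _ => (actionAt_le hQ δ x y).trans_lt
    (EReal.coe_lt_coe_iff.2 (lt_add_one Q))⟩, hself, htri, hclosed,
    fun x hx => (hmem _).2 (hh.action_self_shift ((hmem x).1 hx)), hmax, hnonempty, hW, hsub,
    fun huniq => ⟨uniquelyErgodicOn_of_existsUnique hclosed huniq hsupp
      fun ν hν => (hmax ν hν).2, fun μ hμ => uniquelyErgodicOn_of_existsUnique
        Measure.isClosed_support huniq (fun μ' hμ' => ?_) (hsub μ hμ)⟩⟩
  rw [huniq.unique hμ' hμ]
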